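/- **Theorem (rationality of $f^E_h$, energetic model).** For an integer $h\ge 1$ let $\mathcal G_h$ be the grid graph on $\mathbb N\times\{0,\dots,h-1\}$ (where $0\in\mathbb N$), in which two points are adjacent when their distance is $1$. A growing self-avoiding walk (GSAW) on $\mathcal G_h$ is a finite directed walk that visits no vertex twice and is trapped, i.e. every neighbour of its last vertex lies on the walk. For a GSAW $W$ let $|W|$ be its number of edges and $\|W\|$ its displacement, the difference between the largest and the smallest $x$-coordinate of its vertices. Let $C>0$. If a partially built walk $G$ has endpoint $v$, and $w$ is an unvisited neighbour of $v$, the energy of $w$ is $E(w)=C^{\ell}$, where $\ell$ is the number of neighbours of $w$ that are vertices of $G$, not counting $v$. In the energetic model, the next vertex is $w$ with probability $E(w)\big/\sum_{w'}E(w')$, the sum being over all unvisited neighbours $w'$ of $v$. The probability $p^E_h(W)$ of a GSAW $W$ is the product of the probabilities of its steps. Then, for every $h\ge 1$, the generating function $$f^E_h(x,y,C)=\sum_{W}p^E_h(W)\,x^{|W|}y^{\|W\|},$$ where $W$ ranges over the GSAWs on $\mathcal G_h$ that start at the top-left corner $(0,h-1)$, is rational. That is, there are polynomials $P,Q\in\mathbb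 Q[x,y,C]$ such that for every real $C>0$ one has $Q(0,0,C)\neq 0$ and $$Q(x,y,C)\, f^E_h(x,y,C)=P(x,y,C)$$ as formal power series in $x$ and $y$ with real coefficients. -/

import Mathlib

open Finset

noncomputable section

namespace GSAW

/-- The grid graph on a set `S` of integer points of the plane: the vertices are the points of
`S`, with an edge between any two points at (Euclidean) distance `1`. -/
def gridGraph (S : Set (ℤ × ℤ)) : SimpleGraph S where
  Adj u v := (u.1.1 - v.1.1) ^ 2 + (u.1.2 - v.1.2) ^ 2 = 1
  symm := ⟨fun u v h => by rw [← h]; ring⟩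
  loopless := ⟨fun u h => by simp at h⟩

/-- The points `ℕ × {0, …, h - 1}` of the half-infinite strip of height `h`. -/
def strip (h : ℕ) : Set (ℤ × ℤ) := {p | 0 ≤ p.1 ∧ 0 ≤ p.2 ∧ p.2 < h}

/-- The top-left corner `(0, h - 1)` of the half-infinite strip of height `h ≥ 1`. -/
def corner (h : ℕ) (hh : 1 ≤ h) : strip h :=
  ⟨(0, (h : ℤ) - 1), by
    show (0 : ℤ) ≤ 0 ∧ (0 : ℤ) ≤ (h : ℤ) - 1 ∧ (h : ℤ) - 1 < h
    omega⟩

theorem finite_neighborSet (S : Set (ℤ × ℤ)) (v : S) : ((gridGraph S).neighborSet v).Finite := by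
  have hfin : (Set.Icc (v.1.1 - 1, v.1.2 - 1) (v.1.1 + 1, v.1.2 + 1)).Finite :=
    Set.finite_Icc _ _
  refine (hfin.preimage (f := (Subtype.val : S → ℤ × ℤ)) Subtype.val_injective.injOn).subset
    fun w hw => ?_
  have h1 : (v.1.1 - w.1.1) ^ 2 + (v.1.2 - w.1.2) ^ 2 = 1 := hw
  have ha : (v.1.1 - w.1.1) ^ 2 ≤ 1 := by nlinarith [sq_nonneg (v.1.2 - w.1.2)]
  have hb : (v.1.2 - w.1.2) ^ 2 ≤ 1 := by nlinarith [sq_nonneg (v.1.1 - w.1.1)]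
  rw [sq_le_one_iff_abs_le_one, abs_le] at ha hb
  simp only [Set.mem_preimage, Set.mem_Icc, Prod.le_def]
  omega

instance gridGraph_locallyFinite (S : Set (ℤ × ℤ)) : (gridGraph S).LocallyFinite :=
  fun v => (finite_neighborSet S v).fintype

variable {V : Type*}

/-- A growing self-avoiding walk (GSAW) on `G` starting at `v`: a finite directed walk that visits
no vertex twice and is trapped, i.e. every neighbour of its last vertex lies on the walk. -/
structure Gsaw (G : SimpleGraph V) (v : V) where
  last : V
  walk : G.Walk v last
  isPath : walk.IsPath
  trapped : ∀ w, G.Adj last w → w ∈ walk.support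

section Energetic

variable [DecidableEq V] (G : SimpleGraph V) [G.LocallyFinite]

/-- The energy `C ^ ℓ` of a vertex `w` when the vertices of the partially built walk are those of
`A` and its endpoint is `v`; here `ℓ` is the number of neighbours of `w` in `A` other than `v`. -/
def energy (C : ℝ) (A : Finset V) (v w : V) : ℝ :=
  C ^ #{u ∈ G.neighborFinset w | u ∈ A ∧ u ≠ v}

/-- The probability that the next vertex is `w`, when the vertices of the partially built walk are
those of `A` and its endpoint is `v`: the energy of `w` divided by the total energy of
all unvisited neighbours of `v`. -/
def stepProb (C : ℝ) (A : Finset V) (v w : V) : ℝ :=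
  energy G C A v w / ∑ w' ∈ G.neighborFinset v with w' ∉ A, energy G C A v w'

variable {G}

/-- The vertices visited by the walk `p` during its first `i` steps (including its start). -/
def visited {u v : V} (p : G.Walk u v) (i : ℕ) : Finset V :=
  (range (i + 1)).image p.getVert

/-- The probability of a GSAW under the energetic model: the product of the probabilities of
its steps. -/
def energeticProb (C : ℝ) {v : V} (W : Gsaw G v) : ℝ :=
  ∏ i ∈ range W.walk.length,
    stepProb G C (visited W.walk i) (W.walk.getVert i) (W.walk.getVert (i + 1))

end Energetic

/-- The displacement of a walk on a grid graph: the difference between the largest and the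
smallest `x`-coordinate of its vertices. -/
def displacement {S : Set (ℤ × ℤ)} {u v : S} (p : (gridGraph S).Walk u v) : ℕ :=
  (p.support.toFinset.sup' ⟨u, by simp⟩ (fun w => w.1.1) -
    p.support.toFinset.inf' ⟨u, by simp⟩ (fun w => w.1.1)).toNat

/-- The GSAWs on the grid graph of `S` from `v` with `n` edges and displacement `k`. -/
def gsawsWith (S : Set (ℤ × ℤ)) (v : S) (n k : ℕ) : Set (Gsaw (gridGraph S) v) :=
  {W | W.walk.length = n ∧ displacement W.walk = k}

theorem finite_walks_length [DecidableEq V] (G : SimpleGraph V) [G.LocallyFinite] (n : ℕ) (v : V) :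
    {p : Σ u, G.Walk v u | p.2.length = n}.Finite := by
  induction n generalizing v with
  | zero =>
    refine (Set.finite_singleton (⟨v, .nil⟩ : Σ u, G.Walk v u)).subset ?_
    rintro ⟨u, p⟩ hp
    cases p with
    | nil => rfl
    | cons h q => simp at hp
  | succ n ih =>
    have hf : (⋃ w : G.neighborSet v, (fun p : Σ u, G.Walk w.1 u =>
        (⟨p.1, .cons w.2 p.2⟩ : Σ u, G.Walk v u)) '' {p | p.2.length = n}).Finite :=
      Set.finite_iUnion fun w => (ih w.1).image _
    refine hf.subset ?_
    rintro ⟨u, p⟩ hp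
    cases p with
    | nil => simp at hp
    | cons h q =>
      simp only [Set.mem_iUnion]
      refine ⟨⟨_, h⟩, ⟨u, q⟩, ?_, rfl⟩
      simpa using hp

/-- Only finitely many GSAWs have a given length and displacement, so that the finite sum in
`energeticGF` below is meaningful. -/
theorem finite_gsawsWith (S : Set (ℤ × ℤ)) (v : S) (n k : ℕ) : (gsawsWith S v n k).Finite := by
  have hinj : Function.Injective
      (fun W : Gsaw (gridGraph S) v => (⟨W.last, W.walk⟩ : Σ u, (gridGraph S).Walk v u)) := by
    rintro ⟨l, p, _, _⟩ ⟨l', p', _, _⟩ h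
    simp only [Sigma.mk.injEq] at h
    obtain ⟨rfl, h⟩ := h
    obtain rfl := eq_of_heq h
    rfl
  exact ((finite_walks_length (gridGraph S) n v).preimage hinj.injOn).subset fun W hW => hW.1

/-- The generating function `f_h(x, y, C) = ∑_W p(W) x^|W| y^‖W‖` of the GSAWs `W` on the
half-infinite strip of height `h` that start in the top-left corner, weighted by their
probability under the energetic model with constant `C`, as a formal power series over `ℝ` in
the variables `x` (index `0`) and `y` (index `1`): its coefficient at `x^n y^k` is the sum of the
probabilities of all such GSAWs with `n` edges and displacement `k`. -/
def energeticGF (h : ℕ) (hh : 1 ≤ h) (C : ℝ) : MvPowerSeries (Fin 2) ℝ := fun d =>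
  ∑ W ∈ (finite_gsawsWith (strip h) (corner h hh) (d 0) (d 1)).toFinset, energeticProb C W

/-- The polynomial `P(x, y, C) ∈ ℝ[x, y]` obtained from `P ∈ ℚ[C][x, y]` by giving `C` a real
value. -/
def specialize (C : ℝ) (P : MvPolynomial (Fin 2) (Polynomial ℚ)) : MvPolynomial (Fin 2) ℝ :=
  P.map (Polynomial.aeval C : Polynomial ℚ →ₐ[ℚ] ℝ).toRingHom

end GSAW

end

/-!
Cut the support of a GSAW into the vertices in the columns `≥ 1` and those in the columns `≤ 4`.
Neither list need be a walk, but along both of them the column changes by at most one, and two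
such lists which agree on the columns `1, …, 4` glue in a unique way, because between a vertex in
column `0` and a vertex in a column `≥ 5` there is always one in the columns `1, …, 4`. The factor
of a vertex in the probability of a GSAW only depends on the visited vertices within distance two
of it, so the vertices in column `2` contribute a factor depending on the part in the columns
`≤ 4` only, and those in the columns `≥ 3` a factor depending on the part in the columns `≥ 1` only.
The latter part, translated by one column to the left, is again such a list, with last column
smaller by one.

Hence, for the finitely many possible restrictions `s` of the list to the columns `≤ 3`, the
generating functions `F_s` satisfy a linear system `F = b + y W F` whose coefficients are
polynomials in `x` over the rational functions of `C` without positive poles. As `1 - y W` is the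
identity modulo `y`, its determinant is invertible, and the system has a rational solution.
-/

noncomputable section

namespace GSAW

/-! ### Lists with unit steps -/

section UnitSteps

variable {α : Type*} {f : α → ℤ} {m i j : ℤ} {v : α} {l l' : List α}

/-- The values of `f` along `l`, preceded by the value `m`, change by at most `1` at every step.
The virtual initial value `m` makes this notion stable under truncation of the range of `f`. -/
def HasUnitSteps (f : α → ℤ) (m : ℤ) (l : List α) : Prop :=
  (m :: l.map f).IsChain fun a b => |a - b| ≤ 1

@[simp]
theorem hasUnitSteps_nil : HasUnitSteps f m [] := by
  simp [HasUnitSteps]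

theorem hasUnitSteps_cons :
    HasUnitSteps f m (v :: l) ↔ (m ≤ f v + 1 ∧ f v ≤ m + 1) ∧ HasUnitSteps f (f v) l := by
  rw [HasUnitSteps, List.map_cons, List.isChain_cons_cons, abs_le, HasUnitSteps]
  exact and_congr_left fun _ => by omega

theorem HasUnitSteps.isChain (hl : HasUnitSteps f m l) :
    l.IsChain fun v w => f v ≤ f w + 1 ∧ f w ≤ f v + 1 := by
  induction l generalizing m with
  | nil => exact .nil
  | cons v l ih =>
    rw [hasUnitSteps_cons] at hl
    refine List.isChain_cons.2 ⟨fun w hw => ?_, ih hl.2⟩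
    obtain ⟨q, rfl⟩ := List.head?_eq_some_iff.1 hw
    exact (hasUnitSteps_cons.1 hl.2).1

theorem hasUnitSteps_map {g : α → α} (hg : ∀ v, f (g v) = f v + 1) :
    HasUnitSteps f (m + 1) (l.map g) ↔ HasUnitSteps f m l := by
  induction l generalizing m with
  | nil => simp
  | cons v l ih =>
    rw [List.map_cons, hasUnitSteps_cons, hasUnitSteps_cons, hg, ih]
    exact and_congr_left fun _ => by omega

theorem hasUnitSteps_neg : HasUnitSteps (fun v => -f v) (-m) l ↔ HasUnitSteps f m l := by
  induction l generalizing m with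
  | nil => simp
  | cons v l ih =>
    rw [hasUnitSteps_cons, hasUnitSteps_cons, ih]
    exact and_congr_left fun _ => by omega

theorem HasUnitSteps.filter_le (hl : HasUnitSteps f m l) (j : ℤ) :
    HasUnitSteps f (min m j) (l.filter (f · ≤ j)) := by
  induction l generalizing m with
  | nil => simp
  | cons v l ih =>
    rw [hasUnitSteps_cons] at hl
    have ih := ih hl.2
    by_cases hv : f v ≤ j
    · rw [List.filter_cons_of_pos (by simpa using hv), hasUnitSteps_cons]
      rw [min_eq_left hv] at ih
      exact ⟨by omega, ih⟩
    · rw [List.filter_cons_of_neg (by simpa using hv), min_eq_right (by omega : j ≤ m)]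
      rwa [min_eq_right (by omega)] at ih

theorem HasUnitSteps.filter_ge (hl : HasUnitSteps f m l) (i : ℤ) :
    HasUnitSteps f (max m i) (l.filter (i ≤ f ·)) := by
  have h := (hasUnitSteps_neg.2 hl).filter_le (-i)
  simp only [neg_le_neg_iff] at h
  rwa [min_neg_neg, hasUnitSteps_neg] at h

/-- At the first place where `l` and `l'` differ, the values of `f` are below `i` in one list and
above `j` in the other, while both are within `1` of the preceding value. -/
theorem HasUnitSteps.eq_of_filter_eq (hl : HasUnitSteps f m l) (hl' : HasUnitSteps f m l')
    (hij : i < j) (hle : l.filter (f · ≤ j) = l'.filter (f · ≤ j))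
    (hge : l.filter (i ≤ f ·) = l'.filter (i ≤ f ·)) : l = l' := by
  induction l generalizing m l' with
  | nil => cases l' <;> grind
  | cons v l ih =>
    cases l' with
    | nil => grind
    | cons w l' =>
      rw [hasUnitSteps_cons] at hl hl'
      obtain rfl : v = w := by grind
      rw [ih hl.2 hl'.2 (by grind) (by grind)]

theorem exists_hasUnitSteps_filter_eq {m : ℤ} (hij : i < j) {t r : List α}
    (ht : ∀ v ∈ t, f v ≤ j) (hr : ∀ v ∈ r, i ≤ f v) (htm : HasUnitSteps f (min m j) t)
    (hrm : HasUnitSteps f (max m i) r) (htr : t.filter (i ≤ f ·) = r.filter (f · ≤ j)) :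
    ∃ l, HasUnitSteps f m l ∧ l.filter (f · ≤ j) = t ∧ l.filter (i ≤ f ·) = r := by
  by_cases hlow : ∃ v t', t = v :: t' ∧ f v < i
  · obtain ⟨v, t', rfl, hv⟩ := hlow
    rw [hasUnitSteps_cons] at htm
    obtain ⟨l, hl, hlt, hlr⟩ := exists_hasUnitSteps_filter_eq (m := f v) (t := t') (r := r) hij
      (by grind) hr (by rw [min_eq_left (by omega)]; exact htm.2)
      (by rwa [max_eq_right (by omega)] at hrm ⊢) (by grind)
    exact ⟨v :: l, hasUnitSteps_cons.2 ⟨by omega, hl⟩, by grind, by grind⟩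
  by_cases hhigh : ∃ w r', r = w :: r' ∧ j < f w
  · obtain ⟨w, r', rfl, hw⟩ := hhigh
    rw [hasUnitSteps_cons] at hrm
    obtain ⟨l, hl, hlt, hlr⟩ := exists_hasUnitSteps_filter_eq (m := f w) (t := t) (r := r') hij
      ht (by grind) (by rwa [min_eq_right (by omega)] at htm ⊢)
      (by rw [max_eq_left (by omega)]; exact hrm.2) (by grind)
    exact ⟨w :: l, hasUnitSteps_cons.2 ⟨by omega, hl⟩, by grind, by grind⟩
  match t, r with
  | [], [] => exact ⟨[], by simp⟩
  | [], w :: r => grind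
  | v :: t, [] => grind
  | v :: t, w :: r =>
    obtain rfl : v = w := by grind
    rw [hasUnitSteps_cons] at htm hrm
    have hv : i ≤ f v ∧ f v ≤ j := by grind
    obtain ⟨l, hl, hlt, hlr⟩ := exists_hasUnitSteps_filter_eq (m := f v) (t := t) (r := r) hij
      (by grind) (by grind) (by rw [min_eq_left hv.2]; exact htm.2)
      (by rw [max_eq_left hv.1]; exact hrm.2) (by grind)
    exact ⟨v :: l, hasUnitSteps_cons.2 ⟨by omega, hl⟩, by grind, by grind⟩
termination_by t.length + r.length

end UnitSteps

/-! ### Weights of lists of vertices -/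

theorem Gsaw.support_injective {V : Type*} {G : SimpleGraph V} {v : V} :
    Function.Injective fun W : Gsaw G v => W.walk.support := by
  rintro ⟨a, p, hp, ht⟩ ⟨b, q, hq, hs⟩ (h : p.support = q.support)
  obtain rfl : a = b := by
    rw [← p.getLast_support, ← q.getLast_support]
    simp only [h]
  obtain rfl := SimpleGraph.Walk.ext_support h
  rfl

theorem visited_cons_succ {V : Type*} [DecidableEq V] {G : SimpleGraph V} {u v w : V}
    (h : G.Adj u v) (p : G.Walk v w) (i : ℕ) :
    visited (.cons h p) (i + 1) = insert u (visited p i) := by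
  rw [visited, visited, range_add_one', image_insert, map_eq_image, image_image]
  rfl

theorem neighborFinset_map {V V' : Type*} {G : SimpleGraph V} [G.LocallyFinite]
    {G' : SimpleGraph V'} [G'.LocallyFinite] (φ : G ↪g G') {v : V}
    (hv : ∀ w', G'.Adj (φ v) w' → w' ∈ Set.range φ) :
    G'.neighborFinset (φ v) = (G.neighborFinset v).map φ.toEmbedding := by
  ext w'
  simp only [SimpleGraph.mem_neighborFinset, mem_map, RelEmbedding.coe_toEmbedding]
  constructor
  · intro h
    obtain ⟨w, rfl⟩ := hv w' h
    exact ⟨w, φ.map_adj_iff.1 h, rfl⟩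
  · rintro ⟨w, h, rfl⟩
    exact φ.map_adj_iff.2 h

section Weights

variable {V : Type*} [DecidableEq V] (G : SimpleGraph V) [G.LocallyFinite] (C : ℝ)

theorem energy_filter (P : V → Prop) [DecidablePred P] (A : Finset V) (v : V) {w : V}
    (hP : ∀ u, G.Adj w u → P u) : energy G C (A.filter P) v w = energy G C A v w := by
  rw [energy, energy]
  congr 2
  refine filter_congr fun u hu => ?_
  simp [hP u (by simpa using hu)]

theorem stepProb_filter (P : V → Prop) [DecidablePred P] (A : Finset V) {v w : V}
    (hP : ∀ w, G.Adj v w → P w ∧ ∀ u, G.Adj w u → P u) (hvw : G.Adj v w) :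
    stepProb G C (A.filter P) v w = stepProb G C A v w := by
  rw [stepProb, stepProb, energy_filter G C P A v (hP w hvw).2]
  congr 1
  refine sum_congr (filter_congr fun u hu => ?_) fun u hu => ?_
  · simp [(hP u (by simpa using hu)).1]
  · rw [mem_filter, SimpleGraph.mem_neighborFinset] at hu
    exact energy_filter G C P A v (hP u hu.1).2

/-- The factor of a vertex `v` in the weight `x ^ |W| p(W)` of a GSAW `W`, as a polynomial in `x`,
when `A` is the set of vertices of `W` up to and including `v` and `q` is the list of the vertices
of `W` after `v`. It vanishes if the next vertex is not adjacent to `v`, or if `v` is the last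
vertex but not trapped. -/
def vertexWeight (A : Finset V) (v : V) : List V → Polynomial ℝ
  | [] => if G.neighborFinset v ⊆ A then 1 else 0
  | w :: _ => if w ∈ G.neighborFinset v then .monomial 1 (stepProb G C A v w) else 0

open scoped Classical in
/-- The product of the vertex weights of the elements of `S` along a list of vertices, when the
vertices in `A` have been visited before. -/
def partialWeight (S : Set V) : Finset V → List V → Polynomial ℝ
  | _, [] => 1
  | A, v :: q =>
    (if v ∈ S then vertexWeight G C (insert v A) v q else 1) * partialWeight S (insert v A) q

variable {S T : Set V} {A : Finset V} {v w : V} {l q : List V}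

theorem partialWeight_cons_of_mem (hv : v ∈ S) :
    partialWeight G C S A (v :: q) =
      vertexWeight G C (insert v A) v q * partialWeight G C S (insert v A) q := by
  rw [partialWeight, if_pos hv]

theorem partialWeight_cons_of_notMem (hv : v ∉ S) :
    partialWeight G C S A (v :: q) = partialWeight G C S (insert v A) q := by
  rw [partialWeight, if_neg hv, one_mul]

theorem partialWeight_union (hST : Disjoint S T) :
    partialWeight G C (S ∪ T) A l = partialWeight G C S A l * partialWeight G C T A l := by
  induction l generalizing A with
  | nil => simp [partialWeight]
  | cons v l ih =>
    have hv : ¬(v ∈ S ∧ v ∈ T) := fun h => Set.disjoint_left.1 hST h.1 h.2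
    rw [partialWeight, partialWeight, partialWeight, ih]
    grind

theorem vertexWeight_filter (P : V → Prop) [DecidablePred P] (hq : ∀ w ∈ q.head?, P w)
    (hP : ∀ w, G.Adj v w → P w ∧ ∀ u, G.Adj w u → P u) :
    vertexWeight G C (A.filter P) v (q.filter P) = vertexWeight G C A v q := by
  cases q with
  | nil =>
    have hsub : G.neighborFinset v ⊆ A.filter P ↔ G.neighborFinset v ⊆ A := by
      refine ⟨fun h => h.trans (filter_subset P A), fun h w hw => mem_filter.2 ⟨h hw, ?_⟩⟩
      exact (hP w (by simpa using hw)).1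
    simp only [List.filter_nil, vertexWeight, hsub]
  | cons w q =>
    rw [List.filter_cons_of_pos (by simpa using hq)]
    refine if_ctx_congr Iff.rfl (fun hvw => ?_) fun _ => rfl
    rw [stepProb_filter G C P A hP (by simpa using hvw)]

theorem partialWeight_filter (P : V → Prop) [DecidablePred P] (hS : ∀ v ∈ S, P v)
    (hadj : ∀ v ∈ S, ∀ w, G.Adj v w → P w ∧ ∀ u, G.Adj w u → P u)
    (hl : l.IsChain fun v w => v ∈ S → P w) :
    partialWeight G C S (A.filter P) (l.filter P) = partialWeight G C S A l := by
  induction l generalizing A with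
  | nil => simp [partialWeight]
  | cons v l ih =>
    rw [List.isChain_cons] at hl
    have ih := ih (A := insert v A) hl.2
    by_cases hv : P v
    · rw [filter_insert, if_pos hv] at ih
      rw [List.filter_cons_of_pos (by simpa using hv), partialWeight, partialWeight, ih]
      congr 1
      split_ifs with hvS
      swap; · rfl
      rw [← vertexWeight_filter G C P (fun w hw => hl.1 w hw hvS) (hadj v hvS), filter_insert,
        if_pos hv]
    · rw [List.filter_cons_of_neg (by simpa using hv),
        partialWeight_cons_of_notMem G C fun h => hv (hS v h), ← ih, filter_insert, if_neg hv]

section Map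

variable {V' : Type*} [DecidableEq V'] {G} {G' : SimpleGraph V'} [G'.LocallyFinite] (φ : G ↪g G')

theorem energy_map (A : Finset V) (v w : V) :
    energy G' C (A.map φ.toEmbedding) (φ v) (φ w) = energy G C A v w := by
  rw [energy, energy, ← card_map φ.toEmbedding]
  congr 2
  ext u'
  simp only [mem_filter, SimpleGraph.mem_neighborFinset, mem_map, RelEmbedding.coe_toEmbedding]
  constructor
  · rintro ⟨hw, ⟨u, hu, rfl⟩, hv⟩
    exact ⟨u, ⟨φ.map_adj_iff.1 hw, hu, fun h => hv (h ▸ rfl)⟩, rfl⟩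
  · rintro ⟨u, ⟨hw, hu, hv⟩, rfl⟩
    exact ⟨φ.map_adj_iff.2 hw, ⟨u, hu, rfl⟩, fun h => hv (φ.injective h)⟩

theorem stepProb_map (A : Finset V) {v : V} (w : V)
    (hv : ∀ w', G'.Adj (φ v) w' → w' ∈ Set.range φ) :
    stepProb G' C (A.map φ.toEmbedding) (φ v) (φ w) = stepProb G C A v w := by
  rw [stepProb, stepProb, energy_map, neighborFinset_map φ hv, filter_map, sum_map]
  simp [energy_map]

theorem vertexWeight_map (hv : ∀ w', G'.Adj (φ v) w' → w' ∈ Set.range φ) :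
    vertexWeight G' C (A.map φ.toEmbedding) (φ v) (q.map φ) = vertexWeight G C A v q := by
  cases q with
  | nil => simp only [List.map_nil, vertexWeight, neighborFinset_map φ hv, map_subset_map]
  | cons w q =>
    rw [List.map_cons, vertexWeight, vertexWeight, stepProb_map C φ A w hv,
      neighborFinset_map φ hv]
    exact if_congr (mem_map' φ.toEmbedding) rfl rfl

theorem partialWeight_map {S' : Set V'}
    (hS' : ∀ v, φ v ∈ S' → ∀ w', G'.Adj (φ v) w' → w' ∈ Set.range φ) :
    partialWeight G' C S' (A.map φ.toEmbedding) (l.map φ) = partialWeight G C (φ ⁻¹' S') A l := by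
  induction l generalizing A with
  | nil => simp [partialWeight]
  | cons v l ih =>
    have hmap : insert (φ v) (A.map φ.toEmbedding) = (insert v A).map φ.toEmbedding := by
      rw [map_insert, RelEmbedding.coe_toEmbedding]
    rw [List.map_cons, partialWeight, partialWeight, hmap, ih]
    by_cases hv : φ v ∈ S'
    · rw [if_pos hv, if_pos (Set.mem_preimage.2 hv), vertexWeight_map C φ (hS' v hv)]
    · rw [if_neg hv, if_neg (mt Set.mem_preimage.1 hv)]

end Map

/-! ### Weights of walks -/

theorem isChain_adj_of_partialWeight_ne_zero (hl : partialWeight G C Set.univ A l ≠ 0) :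
    l.IsChain G.Adj := by
  induction l generalizing A with
  | nil => exact .nil
  | cons v l ih =>
    rw [partialWeight_cons_of_mem G C (Set.mem_univ v)] at hl
    refine List.isChain_cons.2 ⟨fun w hw => ?_, ih (right_ne_zero_of_mul hl)⟩
    obtain ⟨q, rfl⟩ := List.head?_eq_some_iff.1 hw
    by_contra hvw
    exact left_ne_zero_of_mul hl (if_neg (by simpa using hvw))

variable {G} {u : V}

theorem partialWeight_support (p : G.Walk u v) :
    partialWeight G C Set.univ A p.support =
      .monomial p.length (∏ i ∈ range p.length,
        stepProb G C (A ∪ visited p i) (p.getVert i) (p.getVert (i + 1))) *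
      if G.neighborFinset v ⊆ A ∪ p.support.toFinset then 1 else 0 := by
  induction p generalizing A with
  | @nil u =>
    simp [partialWeight, vertexWeight]
  | @cons u w v h p ih =>
    have hfirst : A ∪ visited (.cons h p) 0 = insert u A := by simp [visited]
    have hlater (i : ℕ) : A ∪ visited (.cons h p) (i + 1) = insert u A ∪ visited p i := by
      rw [visited_cons_succ, union_insert, insert_union]
    have hall : A ∪ (SimpleGraph.Walk.cons h p).support.toFinset =
        insert u A ∪ p.support.toFinset := by
      rw [SimpleGraph.Walk.support_cons, List.toFinset_cons, union_insert, insert_union]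
    have hhead : vertexWeight G C (insert u A) u p.support =
        .monomial 1 (stepProb G C (insert u A) u w) := by
      rw [← p.cons_tail_support, vertexWeight, if_pos (by simpa using h)]
    rw [hall, SimpleGraph.Walk.support_cons, partialWeight_cons_of_mem G C (Set.mem_univ u), ih,
      hhead, ← mul_assoc, Polynomial.monomial_mul_monomial, SimpleGraph.Walk.length_cons,
      prod_range_succ']
    simp only [hfirst, hlater, SimpleGraph.Walk.getVert_cons_succ, SimpleGraph.Walk.getVert_zero]
    rw [add_comm 1, mul_comm (stepProb _ _ _ _ _)]

theorem partialWeight_gsaw (W : Gsaw G v) :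
    partialWeight G C Set.univ ∅ W.walk.support =
      .monomial W.walk.length (energeticProb C W) := by
  have htrapped : G.neighborFinset W.last ⊆ W.walk.support.toFinset := fun w hw => by
    simpa using W.trapped w (by simpa using hw)
  simp only [partialWeight_support, empty_union, if_pos htrapped, mul_one, energeticProb]

theorem exists_gsaw_support_eq (hl : l.Nodup) (hv : l.head? = some v)
    (hweight : partialWeight G C Set.univ ∅ l ≠ 0) : ∃ W : Gsaw G v, W.walk.support = l := by
  have hne : l ≠ [] := by rintro rfl; simp at hv
  obtain rfl : l.head hne = v := by simpa [List.head?_eq_some_head hne] using hv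
  let p := SimpleGraph.Walk.ofSupport l hne (isChain_adj_of_partialWeight_ne_zero G C hweight)
  have hp : p.support = l := SimpleGraph.Walk.support_ofSupport ..
  rw [← hp, partialWeight_support, empty_union] at hweight
  have htrapped := (ite_ne_right_iff.1 (right_ne_zero_of_mul hweight)).1
  refine ⟨⟨_, p, (SimpleGraph.Walk.isPath_def p).2 (by rwa [hp]), fun w hw => ?_⟩, hp⟩
  simpa using htrapped (by simpa using hw)

end Weights

/-! ### Traces on the strip -/

theorem finite_nodup_lists {α : Type*} {s : Set α} (hs : s.Finite) :
    {l : List α | l.Nodup ∧ ∀ x ∈ l, x ∈ s}.Finite := by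
  have := hs.fintype
  refine ((List.finite_length_le s (Fintype.card s)).image (List.map Subtype.val)).subset ?_
  rintro l ⟨hnodup, hmem⟩
  lift l to List s using hmem
  exact ⟨l, (List.Nodup.of_map _ hnodup).length_le_card, rfl⟩

theorem nodup_of_nodup_filter {α : Type*} {p q : α → Bool} {l : List α} (hpq : ∀ v, p v ∨ q v)
    (hp : (l.filter p).Nodup) (hq : (l.filter q).Nodup) : l.Nodup := by
  induction l with grind

section Strip

variable {h : ℕ}

/-- The column, i.e. the `x`-coordinate, of a point of the strip. -/
def col (v : strip h) : ℤ := v.1.1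

theorem col_nonneg (v : strip h) : 0 ≤ col v := v.2.1

theorem col_le_of_adj {v w : strip h} (hvw : (gridGraph (strip h)).Adj v w) :
    col v ≤ col w + 1 ∧ col w ≤ col v + 1 := by
  have hsq : (col v - col w) ^ 2 ≤ 1 := by
    have : (col v - col w) ^ 2 + (v.1.2 - w.1.2) ^ 2 = 1 := hvw
    nlinarith [sq_nonneg (v.1.2 - w.1.2)]
  rw [sq_le_one_iff_abs_le_one, abs_le] at hsq
  omega

/-- The translation of the strip by one column to the right. -/
def shiftRight (h : ℕ) : gridGraph (strip h) ↪g gridGraph (strip h) where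
  toFun v := ⟨(v.1.1 + 1, v.1.2), ⟨by have := v.2.1; dsimp only; omega, v.2.2⟩⟩
  inj' v w hvw := by simpa [Subtype.ext_iff, Prod.ext_iff] using hvw
  map_rel_iff' {v w} := by
    change (v.1.1 + 1 - (w.1.1 + 1)) ^ 2 + (v.1.2 - w.1.2) ^ 2 = 1 ↔
      (v.1.1 - w.1.1) ^ 2 + (v.1.2 - w.1.2) ^ 2 = 1
    rw [add_sub_add_right_eq_sub]

/-- The translation of the strip by one column to the left. The points of column `0`, which would
leave the strip, are fixed. -/
def shiftLeft (v : strip h) : strip h :=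
  ⟨(max 0 (v.1.1 - 1), v.1.2), ⟨le_max_left _ _, v.2.2⟩⟩

theorem col_shiftRight (v : strip h) : col (shiftRight h v) = col v + 1 := rfl

theorem shiftRight_shiftLeft {v : strip h} (hv : 1 ≤ col v) : shiftRight h (shiftLeft v) = v := by
  refine Subtype.ext (Prod.ext ?_ rfl)
  change max 0 (col v - 1) + 1 = col v
  omega

theorem finite_col_le (h : ℕ) (j : ℤ) : {v : strip h | col v ≤ j}.Finite := by
  refine ((Set.finite_Icc ((0, 0) : ℤ × ℤ) (j, h)).preimage Subtype.val_injective.injOn).subset ?_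
  exact fun v hv => ⟨⟨v.2.1, v.2.2.1⟩, ⟨hv, v.2.2.2.le⟩⟩

/-- A trace is what remains of a self-avoiding walk starting in column `0` when only the vertices
in a range of columns are kept and translated to the columns `0, 1, …`: consecutive vertices need
not be adjacent, but their columns differ by at most `1`. -/
structure IsTrace (r : List (strip h)) : Prop where
  nodup : r.Nodup
  hasUnitSteps : HasUnitSteps col 0 r

/-- The part of a trace in the columns `0, …, j`. -/
def upTo (j : ℤ) (r : List (strip h)) : List (strip h) := r.filter (col · ≤ j)

/-- The part of a trace outside column `0`, translated by one column to the left. -/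
def next (r : List (strip h)) : List (strip h) := (r.filter (1 ≤ col ·)).map shiftLeft

variable {i j : ℤ} {r t : List (strip h)}

theorem mem_upTo {v : strip h} : v ∈ upTo j r ↔ v ∈ r ∧ col v ≤ j := by
  simp [upTo]

theorem upTo_upTo (hij : i ≤ j) : upTo i (upTo j r) = upTo i r := by
  rw [upTo, upTo, List.filter_filter]
  exact List.filter_congr fun v _ => by grind

theorem map_shiftRight_next : (next r).map (shiftRight h) = r.filter (1 ≤ col ·) := by
  rw [next, List.map_map, List.map_congr_left (g := id) fun v hv => ?_, List.map_id]
  exact shiftRight_shiftLeft (by simpa using (List.mem_filter.1 hv).2)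

theorem mem_next {v : strip h} : v ∈ next r ↔ shiftRight h v ∈ r := by
  rw [← List.mem_map_of_injective (shiftRight h).injective, map_shiftRight_next, List.mem_filter,
    col_shiftRight]
  simpa using fun _ => col_nonneg v

theorem upTo_next : upTo j (next r) = next (upTo (j + 1) r) := by
  rw [upTo, next, next, upTo, List.filter_map, List.filter_filter, List.filter_filter]
  congr 1
  refine List.filter_congr fun v _ => ?_
  by_cases hv : 1 ≤ col v
  · have := congrArg col (shiftRight_shiftLeft hv)
    rw [col_shiftRight] at this
    grind
  · simp [hv]

theorem head?_upTo (hr : IsTrace r) (hj : 1 ≤ j) : (upTo j r).head? = r.head? := by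
  cases r with
  | nil => rfl
  | cons v r =>
    have := hasUnitSteps_cons.1 hr.hasUnitSteps
    rw [upTo, List.filter_cons_of_pos (by grind), List.head?_cons, List.head?_cons]

theorem IsTrace.upTo (hr : IsTrace r) (hj : 0 ≤ j) : IsTrace (upTo j r) where
  nodup := hr.nodup.filter _
  hasUnitSteps := by
    have := hr.hasUnitSteps.filter_le j
    rwa [min_eq_left hj] at this

theorem IsTrace.next (hr : IsTrace r) : IsTrace (next r) where
  nodup := .of_map (shiftRight h) (map_shiftRight_next ▸ hr.nodup.filter _)
  hasUnitSteps := by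
    rw [← hasUnitSteps_map (col_shiftRight (h := h)), map_shiftRight_next]
    exact hr.hasUnitSteps.filter_ge 1

theorem IsTrace.ext (hr : IsTrace r) (ht : IsTrace t) (hupTo : GSAW.upTo 4 r = GSAW.upTo 4 t)
    (hnext : GSAW.next r = GSAW.next t) : r = t := by
  refine hr.hasUnitSteps.eq_of_filter_eq ht.hasUnitSteps (i := 1) (j := 4) (by norm_num) hupTo ?_
  rw [← map_shiftRight_next, ← map_shiftRight_next, hnext]

theorem IsTrace.exists_glue (ht : IsTrace t) (ht4 : ∀ v ∈ t, col v ≤ 4) (hr : IsTrace r)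
    (hrt : GSAW.upTo 3 r = GSAW.next t) :
    ∃ l, IsTrace l ∧ GSAW.upTo 4 l = t ∧ GSAW.next l = r := by
  have hfilter : t.filter (1 ≤ col ·) = (r.map (shiftRight h)).filter (col · ≤ 4) := by
    rw [← map_shiftRight_next, ← hrt, GSAW.upTo, List.filter_map]
    congr 1
    exact List.filter_congr fun v _ => by grind [col_shiftRight]
  obtain ⟨l, hl, hlt, hlr⟩ := exists_hasUnitSteps_filter_eq (m := 0) (i := 1) (j := 4)
    (by norm_num) ht4 (List.forall_mem_map.2 fun v _ => by
      have := col_nonneg v; rw [col_shiftRight]; lia)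
    ht.hasUnitSteps ((hasUnitSteps_map col_shiftRight).2 hr.hasUnitSteps) hfilter
  refine ⟨l, ⟨nodup_of_nodup_filter (fun v => ?_) (hlt ▸ ht.nodup)
    (hlr ▸ hr.nodup.map (shiftRight h).injective), hl⟩, hlt, ?_⟩
  · grind
  · rw [← map_shiftRight_next] at hlr
    exact List.map_injective_iff.2 (shiftRight h).injective hlr

theorem finite_boundedTraces (h : ℕ) (j : ℤ) :
    {r : List (strip h) | IsTrace r ∧ ∀ v ∈ r, col v ≤ j}.Finite :=
  (finite_nodup_lists (finite_col_le h j)).subset fun _ hr => ⟨hr.1.nodup, hr.2⟩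

/-- The traces within the columns `0, …, j`. -/
def boundedTraces (h : ℕ) (j : ℤ) : Finset (List (strip h)) := (finite_boundedTraces h j).toFinset

/-- The traces whose last column is `k`. -/
def traces (h k : ℕ) : Finset (List (strip h)) :=
  {r ∈ boundedTraces h k | ∃ v ∈ r, col v = k}

theorem mem_boundedTraces : r ∈ boundedTraces h j ↔ IsTrace r ∧ ∀ v ∈ r, col v ≤ j := by
  simp [boundedTraces]

theorem upTo_mem_boundedTraces (hr : IsTrace r) (hj : 0 ≤ j) : upTo j r ∈ boundedTraces h j :=
  mem_boundedTraces.2 ⟨hr.upTo hj, fun _ hv => (mem_upTo.1 hv).2⟩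

theorem next_mem_boundedTraces (hr : r ∈ boundedTraces h (j + 1)) : next r ∈ boundedTraces h j := by
  rw [mem_boundedTraces] at hr ⊢
  exact ⟨hr.1.next, fun v hv => by grind [hr.2 _ (mem_next.1 hv), col_shiftRight]⟩

theorem mem_traces {k : ℕ} :
    r ∈ traces h k ↔ IsTrace r ∧ (∀ v ∈ r, col v ≤ k) ∧ ∃ v ∈ r, col v = k := by
  rw [traces, mem_filter, mem_boundedTraces, and_assoc]

theorem next_mem_traces_iff (hr : IsTrace r) {k : ℕ} :
    next r ∈ traces h k ↔ r ∈ traces h (k + 1) := by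
  simp only [mem_traces, hr, hr.next, true_and, mem_next, Nat.cast_add_one]
  have hshift (v : strip h) (hv : 1 ≤ col v) (hvr : v ∈ r) :
      shiftRight h (shiftLeft v) ∈ r ∧ col v = col (shiftLeft v) + 1 := by
    rw [← col_shiftRight, shiftRight_shiftLeft hv]
    exact ⟨hvr, rfl⟩
  constructor
  · rintro ⟨hle, v, hv, hvk⟩
    refine ⟨fun w hw => ?_, _, hv, by rw [col_shiftRight, hvk]⟩
    by_cases hw1 : 1 ≤ col w
    · have := hle _ (hshift w hw1 hw).1
      have := (hshift w hw1 hw).2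
      lia
    · lia
  · rintro ⟨hle, v, hv, hvk⟩
    refine ⟨fun w hw => ?_, shiftLeft v, hshift v (by lia) hv |>.1, ?_⟩
    · simpa [col_shiftRight] using hle _ hw
    · have := (hshift v (by lia) hv).2
      lia

theorem sum_traces_succ {M : Type*} [AddCommMonoid M] (f : List (strip h) → List (strip h) → M)
    (k : ℕ) :
    ∑ r ∈ traces h (k + 1), f (upTo 4 r) (next r) =
      ∑ t ∈ boundedTraces h 4, ∑ r ∈ traces h k with upTo 3 r = next t, f t r := by
  rw [sum_sigma']
  refine sum_nbij (fun r => ⟨upTo 4 r, next r⟩) (fun r hr => ?_) (fun r hr t ht hrt => ?_)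
    (fun ⟨t, r⟩ htr => ?_) fun _ _ => rfl
  · have hr' := (mem_traces.1 hr).1
    exact mem_sigma.2 ⟨upTo_mem_boundedTraces hr' (by norm_num),
      mem_filter.2 ⟨(next_mem_traces_iff hr').2 hr, upTo_next⟩⟩
  · rw [Sigma.mk.injEq, heq_eq_eq] at hrt
    exact (mem_traces.1 hr).1.ext (mem_traces.1 ht).1 hrt.1 hrt.2
  · obtain ⟨ht, hr⟩ := mem_sigma.1 htr
    rw [mem_boundedTraces] at ht
    rw [mem_filter] at hr
    obtain ⟨l, hl, rfl, rfl⟩ := ht.1.exists_glue ht.2 (mem_traces.1 hr.1).1 hr.2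
    exact ⟨l, (next_mem_traces_iff hl).1 hr.1, rfl⟩

/-! ### Walks starting in column `0` -/

theorem hasUnitSteps_support {u v : strip h} (p : (gridGraph (strip h)).Walk u v) {m : ℤ}
    (hm : m ≤ col u + 1 ∧ col u ≤ m + 1) : HasUnitSteps col m p.support := by
  induction p generalizing m with
  | nil => simpa [hasUnitSteps_cons] using hm
  | cons huv p ih => exact hasUnitSteps_cons.2 ⟨hm, ih (col_le_of_adj huv)⟩

theorem isTrace_support {u v : strip h} {p : (gridGraph (strip h)).Walk u v} (hp : p.IsPath)
    (hu : col u = 0) : IsTrace p.support where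
  nodup := hp.support_nodup
  hasUnitSteps := hasUnitSteps_support p (by simp [hu])

theorem displacement_eq_iff {u v : strip h} {p : (gridGraph (strip h)).Walk u v} (hu : col u = 0)
    {k : ℕ} : displacement p = k ↔ (∀ w ∈ p.support, col w ≤ k) ∧ ∃ w ∈ p.support, col w = k := by
  have hmin : p.support.toFinset.inf' ⟨u, by simp⟩ col = 0 :=
    le_antisymm (hu ▸ inf'_le col (by simp)) (le_inf' _ _ fun w _ => col_nonneg w)
  obtain ⟨w, hw, hmax⟩ := exists_mem_eq_sup' (s := p.support.toFinset) ⟨u, by simp⟩ col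
  have hdisp : (displacement p : ℤ) = col w := by
    have h0 := col_nonneg w
    change ((p.support.toFinset.sup' _ col - p.support.toFinset.inf' _ col).toNat : ℤ) = _
    rw [hmin, hmax]
    lia
  rw [List.mem_toFinset] at hw
  have hle : ∀ w' ∈ p.support, col w' ≤ col w := fun w' hw' =>
    hmax ▸ le_sup' col (List.mem_toFinset.2 hw')
  rw [← Nat.cast_inj (R := ℤ), hdisp]
  constructor
  · rintro h
    exact ⟨h ▸ hle, w, hw, h⟩
  · rintro ⟨hk, w', hw', hwk'⟩
    exact le_antisymm (hk w hw) (hwk' ▸ hle w' hw')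

theorem support_mem_traces_iff {u v : strip h} {p : (gridGraph (strip h)).Walk u v} (hp : p.IsPath)
    (hu : col u = 0) {k : ℕ} : p.support ∈ traces h k ↔ displacement p = k := by
  rw [mem_traces, displacement_eq_iff hu, and_iff_right (isTrace_support hp hu)]

end Strip

/-! ### Power series in two variables -/

/-- The power series over `ℝ` in `x` (index `0`) and `y` (index `1`). -/
abbrev Series : Type := MvPowerSeries (Fin 2) ℝ

/-- A polynomial in `x` as a power series in `x` and `y`. -/
def polyX : Polynomial ℝ →ₐ[ℝ] Series := Polynomial.aeval (MvPowerSeries.X 0)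

/-- The power series `∑ a_k y ^ k` with coefficients `a_k ∈ ℝ[x]`. -/
def seriesY : (ℕ → Polynomial ℝ) →+ Series where
  toFun a d := (a (d 1)).coeff (d 0)
  map_zero' := rfl
  map_add' a b := funext fun d => Polynomial.coeff_add (a (d 1)) (b (d 1)) (d 0)

theorem coeff_seriesY (d : Fin 2 →₀ ℕ) (a : ℕ → Polynomial ℝ) :
    MvPowerSeries.coeff d (seriesY a) = (a (d 1)).coeff (d 0) := rfl

theorem coeff_X_mul (i : Fin 2) (d : Fin 2 →₀ ℕ) (F : Series) :
    MvPowerSeries.coeff d (MvPowerSeries.X i * F) =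
      if d i = 0 then 0 else MvPowerSeries.coeff (d - Finsupp.single i 1) F := by
  rw [MvPowerSeries.X_def, MvPowerSeries.coeff_monomial_mul]
  simp [Nat.one_le_iff_ne_zero]

theorem seriesY_X_mul (a : ℕ → Polynomial ℝ) :
    seriesY (fun k => .X * a k) = MvPowerSeries.X 0 * seriesY a := by
  ext d
  rw [coeff_X_mul, coeff_seriesY, coeff_seriesY]
  cases hd : d 0 with
  | zero => simp
  | succ n => simp [hd]

theorem seriesY_mul (p : Polynomial ℝ) (a : ℕ → Polynomial ℝ) :
    seriesY (fun k => p * a k) = polyX p * seriesY a := by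
  induction p using Polynomial.induction_on generalizing a with
  | C c =>
    ext d
    simp [polyX, coeff_seriesY, ← Algebra.smul_def]
  | add p q hp hq =>
    simp_rw [add_mul]
    rw [map_add, add_mul, ← hp, ← hq, ← map_add]
    rfl
  | monomial n c ih =>
    have hX : polyX .X = MvPowerSeries.X 0 := Polynomial.aeval_X _
    simp_rw [pow_succ, ← mul_assoc (Polynomial.C c), mul_assoc _ Polynomial.X]
    rw [ih, seriesY_X_mul, map_mul _ _ Polynomial.X, hX, mul_assoc]

theorem seriesY_single_zero (p : Polynomial ℝ) : seriesY (Pi.single 0 p) = polyX p := by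
  have hone : seriesY (Pi.single 0 1) = 1 := by
    ext d
    rw [coeff_seriesY, MvPowerSeries.coeff_one, Pi.single_apply, apply_ite (Polynomial.coeff · _)]
    simp [Polynomial.coeff_one, Finsupp.ext_iff, Fin.forall_fin_two, ← ite_and, and_comm]
  rw [← mul_one (polyX p), ← hone, ← seriesY_mul]
  congr 1
  ext1 k
  rw [Pi.single_apply, Pi.single_apply, mul_ite, mul_one, mul_zero]

theorem seriesY_eq (a : ℕ → Polynomial ℝ) :
    seriesY a = polyX (a 0) + MvPowerSeries.X 1 * seriesY fun k => a (k + 1) := by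
  ext d
  rw [← seriesY_single_zero, map_add, coeff_X_mul, coeff_seriesY, coeff_seriesY, coeff_seriesY]
  cases hd : d 1 with
  | zero => simp
  | succ k => simp [hd]

/-! ### Generating functions of traces -/

section Strip

variable {h : ℕ} {C : ℝ} {r : List (strip h)}

/-- The part of the weight of a trace which comes from the vertices in the columns in `s`. -/
def colWeight (C : ℝ) (s : Set ℤ) (r : List (strip h)) : Polynomial ℝ :=
  partialWeight (gridGraph (strip h)) C (col ⁻¹' s) ∅ r

theorem colWeight_union {s t : Set ℤ} (hst : Disjoint s t) :
    colWeight C (s ∪ t) r = colWeight C s r * colWeight C t r :=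
  partialWeight_union _ C (hst.preimage col)

/-- The vertex weights only depend on the vertices at distance at most two. -/
theorem IsTrace.colWeight_filter (hr : IsTrace r) {s : Set ℤ} (P : ℤ → Prop) [DecidablePred P]
    (hs : ∀ i ∈ s, ∀ j, i - 2 ≤ j → j ≤ i + 2 → P j) :
    colWeight C s (r.filter (P ∘ col)) = colWeight C s r := by
  refine partialWeight_filter (A := ∅) _ C (P ∘ col) (fun v hv => ?_) (fun v hv w hvw => ?_) ?_
  · exact hs _ hv _ (by lia) (by lia)
  · have := col_le_of_adj hvw
    refine ⟨hs _ hv _ (by lia) (by lia), fun u hwu => ?_⟩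
    have := col_le_of_adj hwu
    exact hs _ hv _ (by lia) (by lia)
  · exact hr.hasUnitSteps.isChain.imp fun v w hvw hv => hs _ hv _ (by lia) (by lia)

theorem IsTrace.colWeight_upTo (hr : IsTrace r) {s : Set ℤ} {j : ℤ} (hs : ∀ i ∈ s, i + 2 ≤ j) :
    colWeight C s (GSAW.upTo j r) = colWeight C s r :=
  hr.colWeight_filter (· ≤ j) fun i hi _ _ hij => hij.trans (hs i hi)

theorem IsTrace.colWeight_next (hr : IsTrace r) {i : ℤ} (hi : 2 ≤ i) :
    colWeight C (Set.Ici i) (GSAW.next r) = colWeight C (Set.Ici (i + 1)) r := by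
  rw [← hr.colWeight_filter (1 ≤ ·) (by simp only [Set.mem_Ici]; lia)]
  have hrange (v : strip h) (hv : 1 ≤ col v) : v ∈ Set.range (shiftRight h) :=
    ⟨_, shiftRight_shiftLeft hv⟩
  have hpre : shiftRight h ⁻¹' (col ⁻¹' Set.Ici (i + 1)) = col ⁻¹' Set.Ici i := by
    ext v
    simp [col_shiftRight]
  have hmap := partialWeight_map (A := ∅) (l := GSAW.next r) C (shiftRight h)
    (S' := col ⁻¹' Set.Ici (i + 1)) fun v hv w hvw => hrange w (by
      have := col_le_of_adj hvw
      rw [Set.mem_preimage, Set.mem_Ici] at hv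
      lia)
  rw [hpre, map_shiftRight_next] at hmap
  exact hmap.symm

/-- The sum of the weights of the columns `≥ 2` of the traces with last column `k` and with
restriction `s` to the columns `≤ 3`. -/
def bulkSum (C : ℝ) (s : List (strip h)) (k : ℕ) : Polynomial ℝ :=
  ∑ r ∈ traces h k with upTo 3 r = s, colWeight C (Set.Ici 2) r

theorem bulkSum_succ (s : List (strip h)) (k : ℕ) :
    bulkSum C s (k + 1) = ∑ t ∈ boundedTraces h 4 with upTo 3 t = s,
      colWeight C {2} t * bulkSum C (next t) k := by
  have hweight (r) (hr : r ∈ traces h (k + 1)) :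
      colWeight C (Set.Ici 2) r =
        colWeight C {2} (upTo 4 r) * colWeight C (Set.Ici 2) (next r) := by
    have hr := (mem_traces.1 hr).1
    have hcol : Set.Ici (2 : ℤ) = {2} ∪ Set.Ici (2 + 1) := by
      ext i; simp only [Set.mem_Ici, Set.singleton_union, Set.mem_insert_iff]; lia
    rw [hr.colWeight_upTo (by simp), hr.colWeight_next le_rfl, ← colWeight_union (by simp), ← hcol]
  calc
    _ = ∑ r ∈ traces h (k + 1), if upTo 3 (upTo 4 r) = s then
          colWeight C {2} (upTo 4 r) * colWeight C (Set.Ici 2) (next r) else 0 := by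
      rw [bulkSum, sum_filter]
      simp_rw [upTo_upTo (show (3 : ℤ) ≤ 4 by norm_num)]
      exact sum_congr rfl fun r hr => by rw [hweight r hr]
    _ = _ := by
      rw [sum_traces_succ fun t r => if upTo 3 t = s then
        colWeight C {2} t * colWeight C (Set.Ici 2) r else 0, sum_filter]
      refine sum_congr rfl fun t _ => ?_
      split_ifs
      · rw [bulkSum, mul_sum]
      · exact sum_const_zero

theorem sum_traces_colWeight (v : strip h) (k : ℕ) :
    ∑ r ∈ traces h k with r.head? = some v, colWeight C Set.univ r =
      ∑ s ∈ boundedTraces h 3 with s.head? = some v, colWeight C (Set.Iio 2) s * bulkSum C s k := by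
  have hmaps (r) (hr : r ∈ {r ∈ traces h k | r.head? = some v}) :
      upTo 3 r ∈ {s ∈ boundedTraces h 3 | s.head? = some v} := by
    rw [mem_filter] at hr ⊢
    have hr' := (mem_traces.1 hr.1).1
    exact ⟨upTo_mem_boundedTraces hr' (by norm_num), by rw [head?_upTo hr' (by norm_num), hr.2]⟩
  rw [← sum_fiberwise_of_maps_to hmaps]
  refine sum_congr rfl fun s hs => ?_
  rw [bulkSum, mul_sum, filter_filter]
  refine sum_congr (filter_congr fun r hr => ?_) fun r hr => ?_
  · rw [and_iff_right_of_imp]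
    rintro rfl
    rw [← head?_upTo (mem_traces.1 hr).1 (by norm_num : (1 : ℤ) ≤ 3), (mem_filter.1 hs).2]
  · rw [mem_filter, mem_traces] at hr
    rw [← hr.2, hr.1.1.colWeight_upTo (by simp only [Set.mem_Iio]; lia),
      ← colWeight_union (Set.disjoint_left.2 (by simp)), Set.Iio_union_Ici]

/-- The generating function in `x` and `y` of the weights of the columns `≥ 2` of the traces with
restriction `s` to the columns `≤ 3`, where the exponent of `y` is the last column. -/
def bulkGF (C : ℝ) (s : List (strip h)) : Series := seriesY (bulkSum C s)

/-- Cutting off column `0` turns the restriction `t` to the columns `≤ 4` of a trace into the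
restriction `next t` to the columns `≤ 3` of a shorter trace. -/
theorem bulkGF_eq (s : List (strip h)) :
    bulkGF C s = polyX (bulkSum C s 0) + MvPowerSeries.X 1 *
      ∑ t ∈ boundedTraces h 4 with upTo 3 t = s, polyX (colWeight C {2} t) * bulkGF C (next t) := by
  rw [bulkGF, seriesY_eq]
  simp_rw [bulkSum_succ, bulkGF, ← seriesY_mul, ← map_sum, sum_fn]

theorem coeff_energeticGF (hh : 1 ≤ h) (d : Fin 2 →₀ ℕ) :
    MvPowerSeries.coeff d (energeticGF h hh C) =
      ∑ r ∈ traces h (d 1) with r.head? = some (corner h hh),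
        (colWeight C Set.univ r).coeff (d 0) := by
  have hweight (W : Gsaw (gridGraph (strip h)) (corner h hh)) :
      colWeight C Set.univ W.walk.support = .monomial W.walk.length (energeticProb C W) :=
    partialWeight_gsaw C W
  have hmem (W : Gsaw (gridGraph (strip h)) (corner h hh)) :
      W.walk.support ∈ traces h (d 1) ↔ displacement W.walk = d 1 :=
    support_mem_traces_iff W.isPath rfl
  refine sum_of_injOn (fun W => W.walk.support) Gsaw.support_injective.injOn (fun W hW => ?_)
    (fun r hr hrW => ?_) fun W hW => ?_
  · rw [Set.Finite.coe_toFinset] at hW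
    exact mem_filter.2 ⟨(hmem W).2 hW.2, congrArg List.head? W.walk.cons_tail_support.symm⟩
  · rw [mem_filter] at hr
    by_contra hne
    obtain ⟨W, rfl⟩ := exists_gsaw_support_eq C (mem_traces.1 hr.1).1.nodup hr.2
      (ne_of_apply_ne (Polynomial.coeff · (d 0)) hne)
    rw [hweight, Polynomial.coeff_monomial] at hne
    have hlength := (ite_ne_right_iff.1 hne).1
    exact hrW ⟨W, by simpa using ⟨hlength, (hmem W).1 hr.1⟩, rfl⟩
  · rw [Set.Finite.mem_toFinset] at hW
    rw [hweight, hW.1, Polynomial.coeff_monomial_same]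

theorem energeticGF_eq (hh : 1 ≤ h) :
    energeticGF h hh C = ∑ s ∈ boundedTraces h 3 with s.head? = some (corner h hh),
      polyX (colWeight C (Set.Iio 2) s) * bulkGF C s := by
  ext d
  simp_rw [coeff_energeticGF, ← Polynomial.finsetSum_coeff, sum_traces_colWeight, bulkGF,
    ← seriesY_mul, map_sum, coeff_seriesY, Polynomial.finsetSum_coeff]

end Strip

/-! ### Rational families of power series -/

/-- The positive real numbers. -/
abbrev Pos : Type := {C : ℝ // 0 < C}

/-- `specialize` as a ring homomorphism into the ring of power series. -/
def specializeHom (C : ℝ) : MvPolynomial (Fin 2) (Polynomial ℚ) →+* Series :=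
  MvPolynomial.coeToMvPowerSeries.ringHom.comp
    (MvPolynomial.map (Polynomial.aeval C : Polynomial ℚ →ₐ[ℚ] ℝ).toRingHom)

theorem specializeHom_apply (C : ℝ) (P : MvPolynomial (Fin 2) (Polynomial ℚ)) :
    specializeHom C P = (specialize C P : Series) := rfl

/-- The families of power series, depending on a parameter `C > 0`, that are quotients of
polynomials in `x, y, C` with a denominator whose constant term in `x, y` has no positive zero. -/
def rationalFamilies : Subring (Pos → Series) where
  carrier := {f | ∃ P Q : MvPolynomial (Fin 2) (Polynomial ℚ), ∀ C : Pos,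
    MvPowerSeries.constantCoeff (specializeHom C Q) ≠ 0 ∧
      specializeHom C Q * f C = specializeHom C P}
  zero_mem' := ⟨0, 1, fun C => by simp⟩
  one_mem' := ⟨1, 1, fun C => by simp⟩
  neg_mem' := by
    rintro f ⟨P, Q, h⟩
    exact ⟨-P, Q, fun C => ⟨(h C).1, by simp [(h C).2]⟩⟩
  mul_mem' := by
    rintro f g ⟨P, Q, h⟩ ⟨P', Q', h'⟩
    refine ⟨P * P', Q * Q', fun C => ⟨?_, ?_⟩⟩
    · simpa using ⟨(h C).1, (h' C).1⟩
    · rw [map_mul, map_mul, ← (h C).2, ← (h' C).2, Pi.mul_apply]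
      ring
  add_mem' := by
    rintro f g ⟨P, Q, h⟩ ⟨P', Q', h'⟩
    refine ⟨P * Q' + P' * Q, Q * Q', fun C => ⟨?_, ?_⟩⟩
    · simpa using ⟨(h C).1, (h' C).1⟩
    · rw [map_mul, map_add, map_mul, map_mul, ← (h C).2, ← (h' C).2, Pi.add_apply]
      ring

theorem X_mem_rationalFamilies (i : Fin 2) :
    (fun _ => MvPowerSeries.X i : Pos → Series) ∈ rationalFamilies :=
  ⟨MvPolynomial.X i, 1, fun C => ⟨by simp, by simp [specializeHom_apply, specialize]⟩⟩

theorem inv_mem_rationalFamilies {f : Pos → Series} (hf : f ∈ rationalFamilies)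
    (hf0 : ∀ C, MvPowerSeries.constantCoeff (f C) ≠ 0) : f⁻¹ ∈ rationalFamilies := by
  obtain ⟨P, Q, hPQ⟩ := hf
  refine ⟨Q, P, fun C => ⟨?_, ?_⟩⟩
  · rw [← (hPQ C).2, map_mul]
    exact mul_ne_zero (hPQ C).1 (hf0 C)
  · rw [← (hPQ C).2, Pi.inv_apply, mul_assoc, MvPowerSeries.mul_inv_cancel _ (hf0 C), mul_one]

theorem isUnit_of_constantCoeff_ne_zero {f : rationalFamilies}
    (hf : ∀ C, MvPowerSeries.constantCoeff (f.1 C) ≠ 0) : IsUnit f :=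
  .of_mul_eq_one ⟨_, inv_mem_rationalFamilies f.2 hf⟩ <| Subtype.ext <| funext fun C =>
    MvPowerSeries.mul_inv_cancel _ (hf C)

theorem sum_fun_mem {α ι R : Type*} [Ring R] {K : Subring (α → R)} {s : Finset ι}
    {f : ι → α → R} (hf : ∀ i ∈ s, f i ∈ K) : (fun a => ∑ i ∈ s, f i a) ∈ K := by
  rw [← sum_fn]
  exact sum_mem hf

theorem mem_of_map_mulVec_mem {R ι : Type*} [CommRing R] [Fintype ι] [DecidableEq ι]
    {K : Subring R} {M : Matrix ι ι K} (hM : IsUnit M) {x : ι → R}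
    (hx : ∀ i, (M.map K.subtype).mulVec x i ∈ K) (i : ι) : x i ∈ K := by
  obtain ⟨N, hN⟩ := hM.exists_left_inv
  have hxN : x = (N.map K.subtype).mulVec ((M.map K.subtype).mulVec x) := by
    rw [Matrix.mulVec_mulVec, ← Matrix.map_mul, hN, Matrix.map_one _ (map_zero _) (map_one _),
      Matrix.one_mulVec]
  rw [hxN]
  exact sum_mem fun j _ => mul_mem (N i j).2 (hx j)

theorem isUnit_one_sub_X_smul {ι : Type*} [Fintype ι] [DecidableEq ι]
    (W : Matrix ι ι rationalFamilies) (i : Fin 2) :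
    IsUnit (1 - (⟨fun _ => .X i, X_mem_rationalFamilies i⟩ : rationalFamilies) • W) := by
  refine (Matrix.isUnit_iff_isUnit_det _).2 (isUnit_of_constantCoeff_ne_zero fun C => ?_)
  let φ : rationalFamilies →+* ℝ :=
    (MvPowerSeries.constantCoeff.comp (Pi.evalRingHom _ C)).comp rationalFamilies.subtype
  have hX : φ ⟨fun _ => .X i, X_mem_rationalFamilies i⟩ = 0 := MvPowerSeries.constantCoeff_X i
  change φ (1 - _ • W).det ≠ 0
  rw [RingHom.map_det, map_sub, map_one, RingHom.mapMatrix_apply,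
    Matrix.map_smul' (hf := map_mul φ), hX, zero_smul, sub_zero, Matrix.det_one]
  exact one_ne_zero

theorem mem_rationalFamilies_of_linear_system {ι : Type*} [Fintype ι]
    {f b : ι → Pos → Series} {w : ι → ι → Pos → Series} (hb : ∀ i, b i ∈ rationalFamilies)
    (hw : ∀ i j, w i j ∈ rationalFamilies)
    (hf : ∀ i C, f i C = b i C + MvPowerSeries.X 1 * ∑ j, w i j C * f j C) (i : ι) :
    f i ∈ rationalFamilies := by
  classical
  refine mem_of_map_mulVec_mem (isUnit_one_sub_X_smul (.of fun i j => ⟨w i j, hw i j⟩) 1)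
    (fun i => ?_) i
  convert hb i
  ext1 C
  rw [← RingHom.mapMatrix_apply, map_sub, map_one, RingHom.mapMatrix_apply,
    Matrix.map_smul' (hf := map_mul _), Matrix.sub_mulVec, Matrix.one_mulVec, Matrix.smul_mulVec]
  simp [Matrix.mulVec, dotProduct, hf i C]

/-- The families of real numbers that are quotients of polynomials in `C` with a denominator
without positive zeros. -/
def rationalConsts : Subring (Pos → ℝ) :=
  rationalFamilies.comap ((MvPowerSeries.C (σ := Fin 2) (R := ℝ)).compLeft Pos)

theorem coe_mem_rationalConsts : ((↑) : Pos → ℝ) ∈ rationalConsts :=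
  ⟨MvPolynomial.C .X, 1, fun C => by simp [specializeHom_apply, specialize]⟩

theorem div_mem_rationalConsts {f g : Pos → ℝ} (hf : f ∈ rationalConsts)
    (hg : g ∈ rationalConsts) (hg0 : ∀ C, g C ≠ 0) : f / g ∈ rationalConsts := by
  rw [div_eq_mul_inv]
  refine mul_mem hf ?_
  change (fun C => MvPowerSeries.C (g C)⁻¹) ∈ rationalFamilies
  have hinv := inv_mem_rationalFamilies hg fun C => by simpa using hg0 C
  convert hinv using 2 with C
  simp

/-- The families of polynomials in `x` whose coefficients are quotients of polynomials in `C` with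
a denominator without positive zeros. -/
def rationalPolynomials : Subring (Pos → Polynomial ℝ) :=
  rationalFamilies.comap (polyX.toRingHom.compLeft Pos)

theorem monomial_mem_rationalPolynomials {f : Pos → ℝ} (hf : f ∈ rationalConsts) (n : ℕ) :
    (fun C => .monomial n (f C)) ∈ rationalPolynomials := by
  change (fun C => polyX (.monomial n (f C))) ∈ rationalFamilies
  simp only [polyX, Polynomial.aeval_monomial]
  exact mul_mem hf (pow_mem (X_mem_rationalFamilies 0) n)

section Weights

variable {V : Type*} [DecidableEq V] (G : SimpleGraph V) [G.LocallyFinite]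

theorem energy_mem_rationalConsts (A : Finset V) (v w : V) :
    (fun C : Pos => energy G C A v w) ∈ rationalConsts :=
  pow_mem coe_mem_rationalConsts _

theorem stepProb_mem_rationalConsts (A : Finset V) (v w : V) :
    (fun C : Pos => stepProb G C A v w) ∈ rationalConsts := by
  obtain hN | hN := {w' ∈ G.neighborFinset v | w' ∉ A}.eq_empty_or_nonempty
  · simp only [stepProb, hN, sum_empty, div_zero]
    exact zero_mem _
  · refine div_mem_rationalConsts (energy_mem_rationalConsts G A v w) ?_ fun C =>
      (sum_pos (fun w' _ => pow_pos C.2 _) hN).ne'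
    exact sum_fun_mem fun w' _ => energy_mem_rationalConsts G A v w'

theorem vertexWeight_mem_rationalPolynomials (A : Finset V) (v : V) (q : List V) :
    (fun C : Pos => vertexWeight G C A v q) ∈ rationalPolynomials := by
  cases q with
  | nil =>
    simp only [vertexWeight]
    split_ifs
    exacts [one_mem _, zero_mem _]
  | cons w q =>
    simp only [vertexWeight]
    split_ifs
    exacts [monomial_mem_rationalPolynomials (stepProb_mem_rationalConsts G A v w) 1, zero_mem _]

theorem partialWeight_mem_rationalPolynomials (S : Set V) (A : Finset V) (l : List V) :
    (fun C : Pos => partialWeight G C S A l) ∈ rationalPolynomials := by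
  induction l generalizing A with
  | nil => exact one_mem _
  | cons v l ih =>
    by_cases hv : v ∈ S
    · simp only [partialWeight_cons_of_mem G _ hv]
      exact mul_mem (vertexWeight_mem_rationalPolynomials G _ v l) (ih _)
    · simpa only [partialWeight_cons_of_notMem G _ hv] using ih _

end Weights

variable {h : ℕ}

theorem colWeight_mem_rationalPolynomials (s : Set ℤ) (r : List (strip h)) :
    (fun C : Pos => colWeight C s r) ∈ rationalPolynomials :=
  partialWeight_mem_rationalPolynomials _ _ _ _

theorem bulkSum_mem_rationalPolynomials (s : List (strip h)) (k : ℕ) :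
    (fun C : Pos => bulkSum C s k) ∈ rationalPolynomials :=
  sum_fun_mem fun r _ => colWeight_mem_rationalPolynomials (.Ici 2) r

theorem bulkGF_mem_rationalFamilies {s : List (strip h)} (hs : s ∈ boundedTraces h 3) :
    (fun C : Pos => bulkGF C s) ∈ rationalFamilies := by
  let w (s s' : boundedTraces h 3) (C : Pos) : Series :=
    ∑ t ∈ boundedTraces h 4 with upTo 3 t = s.1 ∧ next t = s'.1, polyX (colWeight C {2} t)
  refine mem_rationalFamilies_of_linear_system (w := w)
    (f := fun (s : boundedTraces h 3) (C : Pos) => bulkGF C s.1)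
    (fun s => bulkSum_mem_rationalPolynomials s.1 0)
    (fun s s' => sum_fun_mem fun t _ => colWeight_mem_rationalPolynomials {2} t)
    (fun s C => ?_) ⟨s, hs⟩
  have hnext (t) (ht : t ∈ {t ∈ boundedTraces h 4 | upTo 3 t = s.1}) :
      next t ∈ boundedTraces h 3 := next_mem_boundedTraces (mem_filter.1 ht).1
  rw [bulkGF_eq, ← sum_fiberwise_of_maps_to hnext, ← sum_coe_sort]
  congr! 3 with s'
  rw [sum_mul, filter_filter]
  exact sum_congr rfl fun t ht => by rw [(mem_filter.1 ht).2.2]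

theorem energeticGF_mem_rationalFamilies (hh : 1 ≤ h) :
    (fun C : Pos => energeticGF h hh C) ∈ rationalFamilies := by
  simp_rw [energeticGF_eq]
  exact sum_fun_mem fun s hs =>
    mul_mem (colWeight_mem_rationalPolynomials (.Iio 2) s)
      (bulkGF_mem_rationalFamilies (mem_filter.1 hs).1)

end GSAW

end

/-- The generating function is the power series expansion of a single rational function `P / Q` of
the three variables `x, y, C`, whose denominator is invertible as a power series in `x, y` for
every positive constant `C`. -/
theorem mainTheorem4 (h : ℕ) (hh : 1 ≤ h) :
    ∃ P Q : MvPolynomial (Fin 2) (Polynomial ℚ), ∀ C : ℝ, 0 < C →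
      MvPolynomial.constantCoeff (GSAW.specialize C Q) ≠ 0 ∧
      (GSAW.specialize C Q : MvPowerSeries (Fin 2) ℝ) * GSAW.energeticGF h hh C =
        (GSAW.specialize C P : MvPowerSeries (Fin 2) ℝ) := by
  obtain ⟨P, Q, hPQ⟩ := GSAW.energeticGF_mem_rationalFamilies hh
  refine ⟨P, Q, fun C hC => ⟨?_, (hPQ ⟨C, hC⟩).2⟩⟩
  have hQ := (hPQ ⟨C, hC⟩).1
  rwa [GSAW.specializeHom_apply, ← MvPowerSeries.coeff_zero_eq_constantCoeff_apply,
    MvPolynomial.coeff_coe] at hQ
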